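/- Let $\kappa_1,\kappa_2>0$ and let $\theta_1,\theta_2,\sigma_1,\sigma_2,\rho,r_0^1,r_0^2$ be real constants. On a probability space $(\Omega,\mathcal F,\mathbb Q)$ let $W^1,W^2$ be two standard Brownian motions with correlation $\rho$ (that is, $(W^1,W^2)$ is a two-dimensional process with independent increments and Gaussian marginals, each $W^i$ is a standard Brownian motion, and $\mathrm{Cov}(W^1_t,W^2_t)=\rho t$ for all $t\ge 0$). Let $r=(r^1,r^2)^\top$ be the solution of $$dr^i_t=\kappa_i(\theta_i-r^i_t)\,dt+\sigma_i\,dW^i_t,\qquad t\ge 0,\ i=1,2,$$ with initial value $(r^1_0,r^2_0)$. For $\tau\ge 0$ put $$\Psi_1(\tau)=-\frac1{\kappa_1}\bigl(1-e^{-\kappa_1\tau}\bigr),\qquad \Psi_2(\tau)=\frac1{\kappa_2}\bigl(1-e^{-\kappa_2\tau}\bigr),$$ \begin{align*} \Phi(\tau)={}&-(\theta_1-\theta_2)\tau-\frac{\theta_1}{\kappa_1}\bigl(e^{-\kappa_1\tau}-1\bigr)+\frac{\theta_2}{\kappa_2}\bigl(e^{-\kappa_2\tau}-1\bigr)\\ &+\frac{\sigma_1^2}{2\kappa_1^2}\Bigl(\tau+\frac2{\kappa_1}e^{-\kappa_1\tau}-\frac1{2\kappa_1}e^{-2\kappa_1\tau}-\frac3{2\kappa_1}\Bigr)\\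 &+\frac{\sigma_2^2}{2\kappa_2^2}\Bigl(\tau+\frac2{\kappa_2}e^{-\kappa_2\tau}-\frac1{2\kappa_2}e^{-2\kappa_2\tau}-\frac3{2\kappa_2}\Bigr)\\ &-\frac{\rho\sigma_1\sigma_2}{\kappa_1\kappa_2}\Bigl(\tau+\frac1{\kappa_1}(e^{-\kappa_1\tau}-1)+\frac1{\kappa_2}(e^{-\kappa_2\tau}-1)-\frac1{\kappa_1+\kappa_2}\bigl(e^{-(\kappa_1+\kappa_2)\tau}-1\bigr)\Bigr). \end{align*} Let $T,\delta\ge 0$ and suppose that the prices of the tenor-$\delta$ bond with maturity $T$ have the exponential-affine form $$P(t,T,\delta)=\exp\bigl(\Phi(T-t)+\Psi_1(T-t)\,r^1_t+\Psi_2(T-t)\,r^2_t\bigr)\quad\text{almost surely, for every } 0\le t\le T.$$ Then $(\log P(t,T,\delta))_{0\le t\le T}$ is a Gaussian process under $\mathbb Q$, with mean function \begin{align*} \mu(t,T,\delta)={}&\Phi(T-t)+\Psi_1(T-t)\bigl(r^1_0e^{-\kappa_1t}+\theta_1(1-e^{-\kappa_1t})\bigr)\\ &+\Psi_2(T-t)\bigl(r^2_0e^{-\kappa_2t}+\theta_2(1-e^{-\kappa_2t})\bigr),\qquad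 0\le t\le T, \end{align*} and with covariance function, for $0\le s,t\le T$, \begin{align*} c(s,t,T,\delta)={}&\Psi_1(T-s)\Psi_1(T-t)\frac{\sigma_1^2}{2\kappa_1}e^{-\kappa_1(s+t)}\bigl(e^{2\kappa_1(s\wedge t)}-1\bigr)\\ &+\Psi_1(T-s)\Psi_2(T-t)\frac{\rho\sigma_1\sigma_2}{\kappa_1+\kappa_2}e^{-(\kappa_1s+\kappa_2t)}\bigl(e^{(\kappa_1+\kappa_2)(s\wedge t)}-1\bigr)\\ &+\Psi_1(T-t)\Psi_2(T-s)\frac{\rho\sigma_1\sigma_2}{\kappa_1+\kappa_2}e^{-(\kappa_1t+\kappa_2s)}\bigl(e^{(\kappa_1+\kappa_2)(t\wedge s)}-1\bigr)\\ &+\Psi_2(T-s)\Psi_2(T-t)\frac{\sigma_2^2}{2\kappa_2}e^{-\kappa_2(s+t)}\bigl(e^{2\kappa_2(s\wedge t)}-1\bigr). \end{align*} -/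

import Mathlib

open MeasureTheory ProbabilityTheory
open scoped NNReal

/-- `W₁` and `W₂` are standard Brownian motions with correlation `ρ` under `Q`: each is a standard
real Brownian motion, the pair `(W₁, W₂)` is a two-dimensional process with independent increments
and Gaussian marginals, and `Cov(W₁(t), W₂(t)) = ρ t`. -/
structure IsCorrelatedBrownianPair {Ω : Type*} [MeasurableSpace Ω]
    (ρ : ℝ) (W₁ W₂ : ℝ≥0 → Ω → ℝ) (Q : Measure Ω) : Prop where
  brownian_fst : IsBrownianReal W₁ Q
  brownian_snd : IsBrownianReal W₂ Q
  indep_increments : HasIndepIncrements (fun (t : ℝ≥0) (ω : Ω) ↦ (W₁ t ω, W₂ t ω)) Q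
  gaussian_pair : ∀ t : ℝ≥0, HasGaussianLaw (fun ω ↦ (W₁ t ω, W₂ t ω)) Q
  covariance_eq : ∀ t : ℝ≥0, cov[W₁ t, W₂ t; Q] = ρ * (t : ℝ)

/-- `r` solves the stochastic differential equation `dr_t = κ (θ - r_t) dt + σ dW_t` with initial
value `r₀`: it has almost surely continuous paths and, almost surely, for all `t ≥ 0`,
`r_t = r₀ + ∫₀ᵗ κ (θ - r_u) du + σ W_t`. The diffusion coefficient is constant and `W₀ = 0` almost
surely, so the stochastic integral `∫₀ᵗ σ dW` is `σ W_t`. -/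
structure IsVasicekSolution {Ω : Type*} [MeasurableSpace Ω]
    (κ θ σ r₀ : ℝ) (W r : ℝ≥0 → Ω → ℝ) (Q : Measure Ω) : Prop where
  continuous_paths : ∀ᵐ ω ∂Q, Continuous (fun t : ℝ≥0 ↦ r t ω)
  integral_equation : ∀ᵐ ω ∂Q, ∀ t : ℝ≥0,
    r t ω = r₀ + (∫ u in (0 : ℝ)..(t : ℝ), κ * (θ - r u.toNNReal ω)) + σ * W t ω

/-- The function `Ψ₁`, at time to maturity `τ`. -/
noncomputable def bondPsi₁ (κ₁ : ℝ) (τ : ℝ) : ℝ :=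
  -(1 / κ₁) * (1 - Real.exp (-κ₁ * τ))

/-- The function `Ψ₂`, at time to maturity `τ`. -/
noncomputable def bondPsi₂ (κ₂ : ℝ) (τ : ℝ) : ℝ :=
  (1 / κ₂) * (1 - Real.exp (-κ₂ * τ))

/-- The function `Φ`, at time to maturity `τ`. -/
noncomputable def bondPhi (κ₁ κ₂ θ₁ θ₂ σ₁ σ₂ ρ : ℝ) (τ : ℝ) : ℝ :=
  -(θ₁ - θ₂) * τ
    - θ₁ / κ₁ * (Real.exp (-κ₁ * τ) - 1)
    + θ₂ / κ₂ * (Real.exp (-κ₂ * τ) - 1)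
    + σ₁ ^ 2 / (2 * κ₁ ^ 2) *
      (τ + 2 / κ₁ * Real.exp (-κ₁ * τ) - 1 / (2 * κ₁) * Real.exp (-2 * κ₁ * τ) - 3 / (2 * κ₁))
    + σ₂ ^ 2 / (2 * κ₂ ^ 2) *
      (τ + 2 / κ₂ * Real.exp (-κ₂ * τ) - 1 / (2 * κ₂) * Real.exp (-2 * κ₂ * τ) - 3 / (2 * κ₂))
    - ρ * σ₁ * σ₂ / (κ₁ * κ₂) *
      (τ + 1 / κ₁ * (Real.exp (-κ₁ * τ) - 1) + 1 / κ₂ * (Real.exp (-κ₂ * τ) - 1)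
        - 1 / (κ₁ + κ₂) * (Real.exp (-(κ₁ + κ₂) * τ) - 1))

/-! Solving each equation by variation of constants gives `r t = r₀ e^{-κt} + θ (1 - e^{-κt}) + σ
e^{-κt} I t`, where `I t = ∫₀ᵗ e^{κu} dW`. The logarithm of the bond price is then a deterministic
function plus a linear combination of two such integrals, and only Gaussianity, means and
covariances of these remain to be found.

No stochastic integration is needed. The integrand is smooth and deterministic, so integration by
parts turns `I t` into `expIntegral`, an ordinary integral of the path. It makes sense both
pathwise, where it solves the equation (`eq_expIntegral_of_vasicek_equation`), and for Brownian
motion seen as a continuous curve in `L²`. The two readings agree almost surely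
(`coeFn_expIntegral_ae_eq`), since the same Riemann sums converge to both.

In `L²` the integrals lie in the closed span of the two Brownian motions. Its elements are Gaussian
because Gaussianity survives `L²` limits (`isClosed_setOf_hasGaussianLaw`), and a family in a linear
space of Gaussian variables is jointly Gaussian. Covariances are inner products, computed from `⟪W₁
s, W₂ t⟫ = ρ min s t` by `inner_expIntegral_expIntegral`. -/

/-! ### Riemann sums, and integrals in `L²` versus pathwise integrals -/

section RiemannSums

open Filter Topology

/-- Left Riemann sums of a continuous function on `[0, t]` converge to its integral. -/
lemma tendsto_riemannSum_intervalIntegral {E : Type*} [NormedAddCommGroup E] [NormedSpace ℝ E]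
    [CompleteSpace E] {f : ℝ → E} (hf : Continuous f) {t : ℝ} (ht : 0 ≤ t) :
    Tendsto (fun n : ℕ ↦ ∑ j ∈ Finset.range n, (t / n) • f (j * (t / n))) atTop
      (𝓝 (∫ u in (0 : ℝ)..t, f u)) := by
  rw [Metric.tendsto_atTop]
  intro ε hε
  have hunif := (isCompact_Icc (a := (0 : ℝ)) (b := t)).uniformContinuousOn_of_continuous
    hf.continuousOn
  rw [Metric.uniformContinuousOn_iff] at hunif
  -- Dividing by `t + 1` covers `t = 0` and makes the total error `ε t / (t + 1)` strictly less than
  -- `ε`.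
  obtain ⟨δ, hδ, hfδ⟩ := hunif (ε / (t + 1)) (by positivity)
  obtain ⟨N, hN⟩ := exists_nat_gt (t / δ)
  refine ⟨N + 1, fun n hn ↦ ?_⟩
  have hn0 : (0 : ℝ) < n := by exact_mod_cast (by omega : 0 < n)
  have hmesh : t / n < δ := by
    rw [div_lt_iff₀ hn0]
    rw [div_lt_iff₀ hδ] at hN
    have : (N : ℝ) ≤ n := by exact_mod_cast (by omega : N ≤ n)
    nlinarith
  have hmesh0 : 0 ≤ t / n := by positivity
  have hsplit : ∫ u in (0 : ℝ)..t, f u =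
      ∑ j ∈ Finset.range n, ∫ u in (j * (t / n) : ℝ)..((j + 1 : ℕ) * (t / n) : ℝ), f u := by
    rw [intervalIntegral.sum_integral_adjacent_intervals (a := fun j : ℕ ↦ (j * (t / n) : ℝ))
      (fun k _ ↦ hf.intervalIntegrable _ _)]
    congr 1
    · simp
    · field_simp
  rw [dist_eq_norm, hsplit, ← Finset.sum_sub_distrib]
  have hterm : ∀ j ∈ Finset.range n, ‖(t / n) • f (j * (t / n)) -
      ∫ u in (j * (t / n) : ℝ)..((j + 1 : ℕ) * (t / n) : ℝ), f u‖ ≤ ε / (t + 1) * (t / n) := by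
    intro j hj
    have hjn : ((j : ℝ) + 1) ≤ n := by exact_mod_cast Finset.mem_range.1 hj
    have hlen : ((j + 1 : ℕ) * (t / n) : ℝ) - j * (t / n) = t / n := by push_cast; ring
    have hle : (j * (t / n) : ℝ) ≤ (j + 1 : ℕ) * (t / n) := by linarith
    have htop : ((j + 1 : ℕ) * (t / n) : ℝ) ≤ t := by
      calc ((j + 1 : ℕ) * (t / n) : ℝ) ≤ n * (t / n) := by push_cast; gcongr
        _ = t := by field_simp
    have hj0 : (0 : ℝ) ≤ j * (t / n) := by positivity
    have hconst : (t / n) • f (j * (t / n)) =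
        ∫ _ in (j * (t / n) : ℝ)..((j + 1 : ℕ) * (t / n) : ℝ), f (j * (t / n)) := by
      rw [intervalIntegral.integral_const, hlen]
    rw [hconst, ← intervalIntegral.integral_sub (by simp) (hf.intervalIntegrable _ _)]
    refine (intervalIntegral.norm_integral_le_of_norm_le_const (C := ε / (t + 1))
      fun u hu ↦ ?_).trans_eq ?_
    · rw [Set.uIoc_of_le hle] at hu
      rw [← dist_eq_norm]
      refine (hfδ _ ⟨hj0, by linarith⟩ u ⟨by linarith [hu.1], hu.2.trans htop⟩ ?_).le
      rw [Real.dist_eq, abs_sub_comm, abs_of_nonneg (by linarith [hu.1])]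
      linarith [hu.2]
    · rw [hlen, abs_of_nonneg hmesh0]
  calc _ ≤ ∑ j ∈ Finset.range n, ε / (t + 1) * (t / n) :=
        (norm_sum_le _ _).trans (Finset.sum_le_sum hterm)
    _ = ε * (t / (t + 1)) := by
      rw [Finset.sum_const, Finset.card_range, nsmul_eq_mul]; field_simp
    _ < ε := by
      have : t / (t + 1) < 1 := by rw [div_lt_one (by positivity)]; linarith
      nlinarith

/-- The integral of a continuous function with values in a closed submodule lies in it. -/
lemma Submodule.intervalIntegral_mem {E : Type*} [NormedAddCommGroup E] [NormedSpace ℝ E]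
    [CompleteSpace E] {V : Submodule ℝ E} (hV : IsClosed (V : Set E)) {f : ℝ → E} (hf : Continuous f)
    (hfV : ∀ u, f u ∈ V) {t : ℝ} (ht : 0 ≤ t) : (∫ u in (0 : ℝ)..t, f u) ∈ V :=
  hV.mem_of_tendsto (tendsto_riemannSum_intervalIntegral hf ht)
    (.of_forall fun _ ↦ V.sum_mem fun _ _ ↦ V.smul_mem _ (hfV _))

variable {Ω : Type*} [MeasurableSpace Ω] {Q : Measure Ω}

/-- For a process with continuous paths that is continuous in `L²`, the `L²`-valued integral is
the pathwise integral. -/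
lemma coeFn_intervalIntegral_ae_eq {W : ℝ → Ω → ℝ} {w : ℝ → Lp ℝ 2 Q}
    (hwW : ∀ u, w u =ᵐ[Q] W u) (hw : Continuous w) (hW : ∀ᵐ ω ∂Q, Continuous fun u ↦ W u ω)
    {t : ℝ} (ht : 0 ≤ t) :
    (∫ u in (0 : ℝ)..t, w u : Lp ℝ 2 Q) =ᵐ[Q] fun ω ↦ ∫ u in (0 : ℝ)..t, W u ω := by
  have hLp := tendsto_riemannSum_intervalIntegral hw ht
  -- `L²` convergence gives almost sure convergence only along a subsequence; this is enough to
  -- identify the limit.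
  obtain ⟨ns, hns, hae⟩ := (tendstoInMeasure_of_tendsto_Lp hLp).exists_seq_tendsto_ae
  have hsum : ∀ n : ℕ, ((∑ j ∈ Finset.range n, (t / n) • w (j * (t / n)) : Lp ℝ 2 Q) : Ω → ℝ)
      =ᵐ[Q] fun ω ↦ ∑ j ∈ Finset.range n, (t / n) • W (j * (t / n)) ω := by
    intro n
    have h1 : ∀ᵐ ω ∂Q, ∀ j : ℕ, ((t / n) • w (j * (t / n)) : Lp ℝ 2 Q) ω
        = (t / n) • W (j * (t / n)) ω := by
      rw [ae_all_iff]
      intro j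
      filter_upwards [Lp.coeFn_smul (t / n) (w (j * (t / n))), hwW (j * (t / n))] with ω h1 h2
      rw [h1, Pi.smul_apply, h2]
    filter_upwards [h1, Lp.coeFn_finsetSum (Finset.range n)
      fun j : ℕ ↦ (t / n) • w (j * (t / n))] with ω h1 h2
    rw [h2]
    simp only [Finset.sum_apply, h1]
  filter_upwards [hae, ae_all_iff.2 hsum, hW] with ω h1 h2 h3
  refine tendsto_nhds_unique h1 ?_
  simp only [h2]
  exact (tendsto_riemannSum_intervalIntegral h3 ht).comp hns.tendsto_atTop

end RiemannSums

/-! ### Gaussian subspaces of `L²` -/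

section GaussianLimits

open Filter Topology

variable {Ω : Type*} [MeasurableSpace Ω] {Q : Measure Ω} [IsProbabilityMeasure Q]

/-- An integral against a probability measure as an inner product in `L²`. -/
lemma integral_eq_inner_one (f : Lp ℝ 2 Q) :
    ∫ ω, f ω ∂Q = inner ℝ ((memLp_const (1 : ℝ)).toLp : Lp ℝ 2 Q) f := by
  rw [L2.inner_def]
  refine integral_congr_ae ?_
  filter_upwards [(memLp_const (μ := Q) (p := 2) (1 : ℝ)).coeFn_toLp] with ω h
  rw [h]
  simp

/-- The covariance of two elements of `L²`. -/
lemma covariance_eq_inner_sub (f g : Lp ℝ 2 Q) :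
    cov[f, g; Q] = inner ℝ f g - (∫ ω, f ω ∂Q) * ∫ ω, g ω ∂Q := by
  rw [covariance_eq_sub (Lp.memLp f) (Lp.memLp g), L2.inner_def]
  congr 1
  refine integral_congr_ae (.of_forall fun ω ↦ ?_)
  simp [mul_comm]

/-- The set of Gaussian elements of `L²` is closed. -/
lemma isClosed_setOf_hasGaussianLaw : IsClosed {f : Lp ℝ 2 Q | HasGaussianLaw f Q} := by
  refine IsSeqClosed.isClosed fun fn f hfn hf ↦ ?_
  obtain ⟨ns, hns, hae⟩ := (tendstoInMeasure_of_tendsto_Lp hf).exists_seq_tendsto_ae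
  have hfs : Tendsto (fun n ↦ fn (ns n)) atTop (𝓝 f) := hf.comp hns.tendsto_atTop
  have hmean : Tendsto (fun n ↦ ∫ ω, fn (ns n) ω ∂Q) atTop (𝓝 (∫ ω, f ω ∂Q)) := by
    simp only [integral_eq_inner_one]
    exact tendsto_const_nhds.inner hfs
  have hvar : Tendsto (fun n ↦ Var[fn (ns n); Q]) atTop (𝓝 (Var[f; Q])) := by
    simp only [← covariance_self (Lp.aestronglyMeasurable _).aemeasurable,
      covariance_eq_inner_sub]
    exact (hfs.inner hfs).sub (hmean.mul hmean)
  have hmeas : ∀ g : Lp ℝ 2 Q, AEMeasurable g Q :=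
    fun g ↦ (Lp.aestronglyMeasurable g).aemeasurable
  rw [Set.mem_ofPred_eq, hasGaussianLaw_iff_charFun_map_eq (hmeas f)]
  intro t
  have hchar : ∀ g : Lp ℝ 2 Q, charFun (Q.map g) t = ∫ ω, Complex.exp (t * g ω * Complex.I) ∂Q := by
    intro g
    rw [charFun_apply_real, integral_map (hmeas g) (by fun_prop)]
  have hrhs : ∀ g : Lp ℝ 2 Q, Complex.exp ((Q[fun ω ↦ inner ℝ t (g ω)] : ℝ) * Complex.I
      - Var[fun ω ↦ inner ℝ t (g ω); Q] / 2) =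
      Complex.exp (((t * ∫ ω, g ω ∂Q : ℝ) : ℂ) * Complex.I - ((t ^ 2 * Var[g; Q] : ℝ) : ℂ) / 2) := by
    intro g
    have h : ∀ ω, inner ℝ t (g ω) = t * g ω := fun ω ↦ by simp [mul_comm]
    simp only [h, integral_const_mul, variance_const_mul]
  rw [hrhs, hchar]
  -- Both sides are limits of the same characteristic functions: one by dominated convergence, the
  -- other because mean and variance are continuous on `L²`.
  refine tendsto_nhds_unique (f := fun n ↦ ∫ ω, Complex.exp (t * fn (ns n) ω * Complex.I) ∂Q)
    (l := atTop) ?_ ?_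
  · refine tendsto_integral_of_dominated_convergence (fun _ ↦ 1) (fun n ↦ ?_)
      (integrable_const _) (fun n ↦ .of_forall fun ω ↦ ?_) ?_
    · have := hmeas (fn (ns n))
      exact AEMeasurable.aestronglyMeasurable (by fun_prop)
    · rw [← Complex.ofReal_mul, Complex.norm_exp_ofReal_mul_I]
    · filter_upwards [hae] with ω hω
      have hcont : Continuous fun x : ℝ ↦ Complex.exp (t * x * Complex.I) := by fun_prop
      exact (hcont.tendsto _).comp hω
  · simp only [← hchar]
    have : ∀ n, charFun (Q.map (fn (ns n))) t =
        Complex.exp (((t * ∫ ω, fn (ns n) ω ∂Q : ℝ) : ℂ) * Complex.I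
          - ((t ^ 2 * Var[fn (ns n); Q] : ℝ) : ℂ) / 2) := by
      intro n
      rw [← hrhs]
      exact (hasGaussianLaw_iff_charFun_map_eq (hmeas _)).1 (hfn (ns n)) t
    simp only [this]
    exact ((((Complex.continuous_ofReal.tendsto _).comp (hmean.const_mul t)).mul_const _).sub
      (((Complex.continuous_ofReal.tendsto _).comp (hvar.const_mul (t ^ 2))).div_const _)).cexp

/-- Every element of the closed linear span in `L²` of a Gaussian process is Gaussian. -/
lemma ProbabilityTheory.IsGaussianProcess.hasGaussianLaw_of_mem_closure_span {T : Type*}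
    {X : T → Ω → ℝ} (hX : IsGaussianProcess X Q) {x : T → Lp ℝ 2 Q} (hx : ∀ t, x t =ᵐ[Q] X t)
    {z : Lp ℝ 2 Q} (hz : z ∈ (Submodule.span ℝ (Set.range x)).topologicalClosure) :
    HasGaussianLaw z Q := by
  have hsub : (Submodule.span ℝ (Set.range x) : Set (Lp ℝ 2 Q)) ⊆ {f | HasGaussianLaw f Q} := by
    intro f hf
    obtain ⟨c, rfl⟩ := Finsupp.mem_span_range_iff_exists_finsupp.1 hf
    let L : (c.support → ℝ) →L[ℝ] ℝ := ∑ i : c.support, c i • ContinuousLinearMap.proj i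
    refine ((hX.hasGaussianLaw c.support).map L).congr ?_
    have h1 : ∀ᵐ ω ∂Q, ∀ i : c.support, (c i • x i : Lp ℝ 2 Q) ω = c i • X i ω := by
      rw [ae_all_iff]
      intro i
      filter_upwards [Lp.coeFn_smul (c i) (x i), hx i] with ω h1 h2
      rw [h1, Pi.smul_apply, h2]
    filter_upwards [h1, Lp.coeFn_finsetSum c.support fun i ↦ c i • x i] with ω h1 h2
    rw [Finsupp.sum, h2, Finset.sum_apply, ← Finset.sum_coe_sort]
    simp [L, h1]
  exact isClosed_setOf_hasGaussianLaw.closure_subset_iff.2 hsub hz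

omit [IsProbabilityMeasure Q] in
/-- A family in a linear space of Gaussian elements of `L²` is a Gaussian process. -/
lemma isGaussianProcess_of_mem_submodule {S : Type*} {V : Submodule ℝ (Lp ℝ 2 Q)}
    (hV : ∀ z ∈ V, HasGaussianLaw z Q) {z : S → Lp ℝ 2 Q} (hz : ∀ s, z s ∈ V) :
    IsGaussianProcess (fun s ω ↦ z s ω) Q where
  hasGaussianLaw I := by
    classical
    have hmeas : AEMeasurable (fun ω ↦ I.restrict fun s ↦ z s ω) Q :=
      aemeasurable_pi_lambda _ fun i ↦ (hV _ (hz i)).aemeasurable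
    -- A vector is Gaussian once all its linear functionals are, and `L` applied to the vector is
    -- again an element of `V`.
    refine ⟨isGaussian_of_isGaussian_map fun L ↦ ?_⟩
    rw [AEMeasurable.map_map_of_aemeasurable (by fun_prop) hmeas]
    have hL : (∑ i : I, L (Pi.single i 1) • z i : Lp ℝ 2 Q) ∈ V :=
      V.sum_mem fun i _ ↦ V.smul_mem _ (hz i)
    refine ((hV _ hL).congr ?_).isGaussian_map
    have h1 : ∀ᵐ ω ∂Q, ∀ i : I, (L (Pi.single i 1) • z i : Lp ℝ 2 Q) ω
        = L (Pi.single i 1) * z i ω := by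
      rw [ae_all_iff]
      intro i
      filter_upwards [Lp.coeFn_smul (L (Pi.single i 1)) (z i)] with ω h1
      rw [h1, Pi.smul_apply, smul_eq_mul]
    filter_upwards [h1, Lp.coeFn_finsetSum Finset.univ fun i : I ↦ L (Pi.single i 1) • z i]
      with ω h1 h2
    have h3 := L.toLinearMap.pi_apply_eq_sum_univ (I.restrict fun s ↦ z s ω)
    simp only [ContinuousLinearMap.coe_coe] at h3
    rw [h2, Finset.sum_apply, Function.comp_apply, h3]
    refine Finset.sum_congr rfl fun i _ ↦ ?_
    rw [h1, mul_comm, smul_eq_mul]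
    change z i ω * _ = z i ω * _
    congr 2
    ext j
    simp [Pi.single_apply, eq_comm]

omit [IsProbabilityMeasure Q] in
/-- A Gaussian process plus a deterministic function is a Gaussian process. -/
lemma ProbabilityTheory.IsGaussianProcess.const_add {S : Type*} {X : S → Ω → ℝ}
    (hX : IsGaussianProcess X Q) (m : S → ℝ) : IsGaussianProcess (fun s ω ↦ m s + X s ω) Q where
  hasGaussianLaw I := by
    have := (hX.hasGaussianLaw I).isGaussian_map
    refine ⟨?_⟩
    have h : (fun ω ↦ I.restrict fun s ↦ m s + X s ω) =
        (fun x ↦ I.restrict m + x) ∘ fun ω ↦ I.restrict fun s ↦ X s ω := rfl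
    rw [h, ← AEMeasurable.map_map_of_aemeasurable (by fun_prop)
      (hX.hasGaussianLaw I).aemeasurable]
    infer_instance

end GaussianLimits

/-! ### Exponential integrals by parts and their inner products -/

section ExpIntegral

variable {E : Type*} [NormedAddCommGroup E]

/-- The integral `∫₀ᵗ exp (κ u) dw_u` of an exponential against a continuous path `w` started
at `0`, defined through integration by parts. -/
noncomputable def expIntegral [NormedSpace ℝ E] (κ : ℝ) (w : ℝ → E) (t : ℝ) : E :=
  Real.exp (κ * t) • w t - κ • ∫ u in (0 : ℝ)..t, Real.exp (κ * u) • w u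

lemma expIntegral_mem [NormedSpace ℝ E] [CompleteSpace E] {V : Submodule ℝ E}
    (hV : IsClosed (V : Set E)) {w : ℝ → E} (hw : Continuous w) (hwV : ∀ u, w u ∈ V) (κ : ℝ)
    {t : ℝ} (ht : 0 ≤ t) : expIntegral κ w t ∈ V :=
  V.sub_mem (V.smul_mem _ (hwV t)) (V.smul_mem _ (Submodule.intervalIntegral_mem hV
    (by fun_prop) (fun u ↦ V.smul_mem _ (hwV u)) ht))

lemma expIntegral_zero (κ t : ℝ) : expIntegral κ (fun _ ↦ (0 : ℝ)) t = 0 := by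
  simp [expIntegral]

lemma expIntegral_congr [NormedSpace ℝ E] {κ t : ℝ} (ht : 0 ≤ t) {v w : ℝ → E}
    (h : ∀ u, 0 ≤ u → v u = w u) : expIntegral κ v t = expIntegral κ w t := by
  have hint : ∫ u in (0 : ℝ)..t, Real.exp (κ * u) • v u =
      ∫ u in (0 : ℝ)..t, Real.exp (κ * u) • w u := by
    refine intervalIntegral.integral_congr fun u hu ↦ ?_
    rw [Set.uIcc_of_le ht] at hu
    simp only [h u hu.1]
  rw [expIntegral, expIntegral, h t ht, hint]

/-- A continuous linear functional passes under the integral. Inner products of `E`-valued integrals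
thus reduce to integrals of real paths. -/
lemma inner_expIntegral [InnerProductSpace ℝ E] [CompleteSpace E] {w : ℝ → E}
    (hw : Continuous w) (x : E) (κ t : ℝ) :
    inner ℝ x (expIntegral κ w t) = expIntegral κ (fun u ↦ inner ℝ x (w u)) t := by
  have hint := (innerSL ℝ x).intervalIntegral_comp_comm (μ := volume) (a := 0) (b := t)
    (f := fun u ↦ Real.exp (κ * u) • w u)
    ((Continuous.intervalIntegrable (by fun_prop) _ _))
  simp only [innerSL_apply_apply, inner_smul_right] at hint
  simp only [expIntegral, inner_sub_right, inner_smul_right, smul_eq_mul, hint]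

/-- Integration by parts for a differentiable path stopped at `s`. -/
lemma expIntegral_stopped {g g' : ℝ → ℝ} (hg : ∀ u, HasDerivAt g (g' u) u)
    (hg' : Continuous g') (hg0 : g 0 = 0) (κ : ℝ) {s t : ℝ} (hs : 0 ≤ s) (ht : 0 ≤ t) :
    expIntegral κ (fun v ↦ g (min s v)) t =
      ∫ v in (0 : ℝ)..min s t, Real.exp (κ * v) * g' v := by
  have hgc : Continuous g := continuous_iff_continuousAt.2 fun u ↦ (hg u).continuousAt
  have hexp : ∀ v, HasDerivAt (fun v ↦ Real.exp (κ * v)) (Real.exp (κ * v) * κ) v := fun v ↦ by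
    simpa using ((hasDerivAt_id v).const_mul κ).exp
  have hparts : ∀ m, ∫ v in (0 : ℝ)..m, Real.exp (κ * v) * g' v =
      Real.exp (κ * m) * g m - κ * ∫ v in (0 : ℝ)..m, Real.exp (κ * v) * g v := by
    intro m
    rw [intervalIntegral.integral_mul_deriv_eq_deriv_mul (fun v _ ↦ hexp v) (fun v _ ↦ hg v)
      (Continuous.intervalIntegrable (by fun_prop) _ _)
      (Continuous.intervalIntegrable (by fun_prop) _ _), hg0, mul_zero, sub_zero,
      ← intervalIntegral.integral_const_mul]
    congr 2
    ext v
    ring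
  rw [hparts, expIntegral]
  simp only [smul_eq_mul]
  have hinit : ∀ m, 0 ≤ m → m ≤ s → ∫ v in (0 : ℝ)..m, Real.exp (κ * v) * g (min s v) =
      ∫ v in (0 : ℝ)..m, Real.exp (κ * v) * g v := by
    intro m hm hms
    refine intervalIntegral.integral_congr fun v hv ↦ ?_
    rw [Set.uIcc_of_le hm] at hv
    simp only [min_eq_right (hv.2.trans hms)]
  rcases le_total t s with hts | hst
  · rw [min_eq_right hts, hinit t ht hts]
  -- After time `s` the path is frozen at `g s`, so this tail replaces the boundary term at `t` by
  -- the one at `s`.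
  · have htail : κ * ∫ v in s..t, Real.exp (κ * v) * g (min s v) =
        (Real.exp (κ * t) - Real.exp (κ * s)) * g s := by
      rw [← intervalIntegral.integral_eq_sub_of_hasDerivAt (fun v _ ↦ hexp v)
        (Continuous.intervalIntegrable (by fun_prop) _ _), ← intervalIntegral.integral_const_mul,
        ← intervalIntegral.integral_mul_const]
      refine intervalIntegral.integral_congr fun v hv ↦ ?_
      rw [Set.uIcc_of_le hst] at hv
      simp only [min_eq_left hv.1]
      ring
    rw [min_eq_left hst, ← intervalIntegral.integral_add_adjacent_intervals (b := s)
      (Continuous.intervalIntegrable (by fun_prop) _ _)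
      (Continuous.intervalIntegrable (by fun_prop) _ _), hinit s hs le_rfl, mul_add, htail]
    ring

lemma integral_exp_const_mul {κ : ℝ} (hκ : κ ≠ 0) (t : ℝ) :
    ∫ u in (0 : ℝ)..t, Real.exp (κ * u) = (Real.exp (κ * t) - 1) / κ := by
  rw [intervalIntegral.integral_comp_mul_left _ hκ, integral_exp]
  simp [div_eq_inv_mul]

/-- Itô isometry for exponential integrands, with respect to a pair of paths in a Hilbert space
with the covariance of correlated Brownian motions. -/
lemma inner_expIntegral_expIntegral [InnerProductSpace ℝ E] [CompleteSpace E] {v w : ℝ → E}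
    (hv : Continuous v) (hw : Continuous w) {ρ : ℝ}
    (h : ∀ s t, 0 ≤ s → 0 ≤ t → inner ℝ (v s) (w t) = ρ * min s t) {κ l : ℝ} (hκ : 0 < κ)
    (hl : 0 < l) {s t : ℝ} (hs : 0 ≤ s) (ht : 0 ≤ t) :
    inner ℝ (expIntegral κ v s) (expIntegral l w t) =
      ρ / (κ + l) * (Real.exp ((κ + l) * min s t) - 1) := by
  -- With `u` fixed, `r ↦ ⟪v r, w u⟫` is the line `ρ r` stopped at `u`. The result is again a
  -- differentiable function of `u` stopped at `s`, so `expIntegral_stopped` applies a second time.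
  have hone : ∀ u, 0 ≤ u → inner ℝ (expIntegral κ v s) (w u) =
      ρ * ((Real.exp (κ * min s u) - 1) / κ) := by
    intro u hu
    rw [real_inner_comm, inner_expIntegral hv,
      expIntegral_congr hs (w := fun r ↦ ρ * min u r)
        (fun r hr ↦ by rw [real_inner_comm, h r u hr hu, min_comm]),
      expIntegral_stopped (g := fun r ↦ ρ * r) (g' := fun _ ↦ ρ)
        (fun r ↦ by simpa using (hasDerivAt_id r).const_mul ρ) continuous_const (by simp) κ hu hs,
      intervalIntegral.integral_mul_const, integral_exp_const_mul hκ.ne', min_comm, mul_comm]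
  rw [inner_expIntegral hw, expIntegral_congr ht hone,
    expIntegral_stopped (g := fun r ↦ ρ * ((Real.exp (κ * r) - 1) / κ))
      (g' := fun r ↦ ρ * Real.exp (κ * r)) (fun r ↦ ?_) (by fun_prop) (by simp) l hs ht]
  · have hexp : ∀ r : ℝ, Real.exp (l * r) * (ρ * Real.exp (κ * r)) =
        ρ * Real.exp ((κ + l) * r) := by
      intro r
      rw [add_mul, Real.exp_add]
      ring
    simp only [hexp]
    rw [intervalIntegral.integral_const_mul, integral_exp_const_mul (by positivity)]
    ring
  · have := ((((hasDerivAt_id r).const_mul κ).exp.sub_const 1).div_const κ).const_mul ρ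
    convert! this using 1
    simp [hκ.ne']

/-- A path in a Hilbert space with the covariance of Brownian motion is continuous. -/
lemma continuous_of_inner_eq_min [InnerProductSpace ℝ E] {w : ℝ≥0 → E}
    (h : ∀ s t, inner ℝ (w s) (w t) = min (s : ℝ) t) : Continuous w := by
  rw [continuous_iff_continuousAt]
  intro t
  rw [ContinuousAt, tendsto_iff_norm_sub_tendsto_zero]
  have hnorm : ∀ s, ‖w s - w t‖ = √((s : ℝ) - 2 * min (s : ℝ) t + t) := by
    intro s
    rw [← Real.sqrt_sq (norm_nonneg _), norm_sub_sq_real, ← real_inner_self_eq_norm_sq,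
      ← real_inner_self_eq_norm_sq, h, h, h, min_self, min_self]
  simp only [hnorm]
  have hcont : Continuous fun s : ℝ≥0 ↦ √((s : ℝ) - 2 * min (s : ℝ) t + t) := by fun_prop
  have h0 : (t : ℝ) - 2 * t + t = 0 := by ring
  simpa [h0] using hcont.tendsto t

end ExpIntegral

/-! ### Solving the Vasicek equation pathwise -/

section Vasicek

/-- Variation of constants for the Vasicek equation. -/
lemma eq_expIntegral_of_vasicek_equation {κ θ σ r₀ : ℝ} {w r : ℝ → ℝ} (hw : Continuous w)
    (hr : Continuous r)
    (h : ∀ t, 0 ≤ t → r t = r₀ + (∫ u in (0 : ℝ)..t, κ * (θ - r u)) + σ * w t)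
    {t : ℝ} (ht : 0 ≤ t) :
    r t = r₀ * Real.exp (-κ * t) + θ * (1 - Real.exp (-κ * t))
      + σ * Real.exp (-κ * t) * expIntegral κ w t := by
  have hdrift : ∀ u, HasDerivAt (fun t ↦ ∫ u in (0 : ℝ)..t, κ * (θ - r u)) (κ * (θ - r u)) u :=
    fun u ↦ intervalIntegral.integral_hasDerivAt_right
      (Continuous.intervalIntegrable (by fun_prop) _ _)
      (Continuous.stronglyMeasurableAtFilter (by fun_prop) _ _)
      (Continuous.continuousAt (by fun_prop))
  have hpath : ∀ u, HasDerivAt (fun t ↦ ∫ u in (0 : ℝ)..t, Real.exp (κ * u) * w u)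
      (Real.exp (κ * u) * w u) u :=
    fun u ↦ intervalIntegral.integral_hasDerivAt_right
      (Continuous.intervalIntegrable (by fun_prop) _ _)
      (Continuous.stronglyMeasurableAtFilter (by fun_prop) _ _)
      (Continuous.continuousAt (by fun_prop))
  have hexp : ∀ u, HasDerivAt (fun v ↦ Real.exp (κ * v)) (Real.exp (κ * u) * κ) u := fun u ↦ by
    simpa using ((hasDerivAt_id u).const_mul κ).exp
  -- `F` is `e^{κt} (r t - θ) - σ expIntegral κ w t` with the equation substituted for `r t`. The
  -- terms in `e^{κt} w t` cancel, so `F` is differentiable although `w` need not be.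
  let F : ℝ → ℝ := fun t ↦ Real.exp (κ * t) * (∫ u in (0 : ℝ)..t, κ * (θ - r u))
    + (r₀ - θ) * Real.exp (κ * t) + κ * σ * ∫ u in (0 : ℝ)..t, Real.exp (κ * u) * w u
  have hF : ∀ u, HasDerivAt F (Real.exp (κ * u) * κ * (∫ v in (0 : ℝ)..u, κ * (θ - r v))
      + Real.exp (κ * u) * (κ * (θ - r u)) + (r₀ - θ) * (Real.exp (κ * u) * κ)
      + κ * σ * (Real.exp (κ * u) * w u)) u := fun u ↦
    (((hexp u).mul (hdrift u)).add ((hexp u).const_mul (r₀ - θ))).add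
      ((hpath u).const_mul (κ * σ))
  have hconst : F t = F 0 := by
    refine constant_of_has_deriv_right_zero
      (fun u _ ↦ (hF u).continuousAt.continuousWithinAt) (fun u hu ↦ ?_) t ⟨ht, le_rfl⟩
    have hzero : Real.exp (κ * u) * κ * (∫ v in (0 : ℝ)..u, κ * (θ - r v))
        + Real.exp (κ * u) * (κ * (θ - r u)) + (r₀ - θ) * (Real.exp (κ * u) * κ)
        + κ * σ * (Real.exp (κ * u) * w u) = 0 := by
      rw [h u hu.1]
      ring
    exact hzero ▸ (hF u).hasDerivWithinAt
  simp only [F, intervalIntegral.integral_same, mul_zero, Real.exp_zero] at hconst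
  have hinv : Real.exp (-κ * t) * Real.exp (κ * t) = 1 := by
    rw [← Real.exp_add]
    simp
  rw [h t ht]
  simp only [expIntegral, smul_eq_mul]
  linear_combination Real.exp (-κ * t) * hconst -
    ((∫ u in (0 : ℝ)..t, κ * (θ - r u)) + r₀ - θ + σ * w t) * hinv

variable {Ω : Type*} [MeasurableSpace Ω] {Q : Measure Ω} {κ θ σ r₀ : ℝ} {W r : ℝ≥0 → Ω → ℝ}

lemma IsVasicekSolution.ae_eq_expIntegral (hr : IsVasicekSolution κ θ σ r₀ W r Q)
    (hW : ∀ᵐ ω ∂Q, Continuous (W · ω)) :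
    ∀ᵐ ω ∂Q, ∀ t : ℝ≥0, r t ω = r₀ * Real.exp (-κ * t) + θ * (1 - Real.exp (-κ * t))
      + σ * Real.exp (-κ * t) * expIntegral κ (fun u ↦ W u.toNNReal ω) t := by
  filter_upwards [hr.continuous_paths, hr.integral_equation, hW] with ω hc he hWω t
  have := eq_expIntegral_of_vasicek_equation (κ := κ) (θ := θ) (σ := σ) (r₀ := r₀)
    (w := fun u ↦ W u.toNNReal ω) (r := fun u ↦ r u.toNNReal ω)
    (hWω.comp continuous_real_toNNReal) (hc.comp continuous_real_toNNReal)
    (fun u hu ↦ by simpa [hu] using he u.toNNReal) t.2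
  simpa using this

/-- The `L²`-valued exponential integral agrees with the pathwise one. -/
lemma coeFn_expIntegral_ae_eq {W : ℝ → Ω → ℝ} {w : ℝ → Lp ℝ 2 Q}
    (hwW : ∀ u, w u =ᵐ[Q] W u) (hw : Continuous w) (hW : ∀ᵐ ω ∂Q, Continuous fun u ↦ W u ω)
    (κ : ℝ) {t : ℝ} (ht : 0 ≤ t) :
    (expIntegral κ w t : Lp ℝ 2 Q) =ᵐ[Q] fun ω ↦ expIntegral κ (fun u ↦ W u ω) t := by
  have hint := coeFn_intervalIntegral_ae_eq (W := fun u ω ↦ Real.exp (κ * u) • W u ω)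
    (w := fun u ↦ Real.exp (κ * u) • w u) (Q := Q) (fun u ↦ by
      filter_upwards [Lp.coeFn_smul (Real.exp (κ * u)) (w u), hwW u] with ω h1 h2
      rw [h1, Pi.smul_apply, h2]) (by fun_prop) (by filter_upwards [hW] with ω h; fun_prop) ht
  filter_upwards [hint, hwW t, Lp.coeFn_smul (Real.exp (κ * t)) (w t),
    Lp.coeFn_smul κ (∫ u in (0 : ℝ)..t, Real.exp (κ * u) • w u),
    Lp.coeFn_sub (Real.exp (κ * t) • w t) (κ • ∫ u in (0 : ℝ)..t, Real.exp (κ * u) • w u)]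
    with ω h1 h2 h3 h4 h5
  simp only [expIntegral]
  rw [h5, Pi.sub_apply, h3, h4, Pi.smul_apply, Pi.smul_apply, h1, h2]

end Vasicek

/-! ### Joint law of the correlated pair -/

section CorrelatedBrownianPair

variable {Ω : Type*} [MeasurableSpace Ω] {Q : Measure Ω} {ρ : ℝ} {W₁ W₂ : ℝ≥0 → Ω → ℝ}

lemma covariance_congr_ae {X X' Y Y' : Ω → ℝ} (hX : X =ᵐ[Q] X') (hY : Y =ᵐ[Q] Y') :
    cov[X, Y; Q] = cov[X', Y'; Q] := by
  simp only [covariance, integral_congr_ae hX, integral_congr_ae hY]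
  refine integral_congr_ae ?_
  filter_upwards [hX, hY] with ω h1 h2
  rw [h1, h2]

namespace IsCorrelatedBrownianPair

lemma isGaussianProcess_pair (hW : IsCorrelatedBrownianPair ρ W₁ W₂ Q) :
    IsGaussianProcess (fun (t : ℝ≥0) (ω : Ω) ↦ (W₁ t ω, W₂ t ω)) Q := by
  refine hW.indep_increments.isGaussianProcess hW.gaussian_pair ?_
  filter_upwards [hW.brownian_fst.eval_zero_ae_eq_zero, hW.brownian_snd.eval_zero_ae_eq_zero]
    with ω h1 h2
  simp [h1, h2]

lemma isGaussianProcess_sumElim (hW : IsCorrelatedBrownianPair ρ W₁ W₂ Q) :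
    IsGaussianProcess (Sum.elim W₁ W₂) Q := by
  refine hW.isGaussianProcess_pair.of_isGaussianProcess ?_
  rintro (t | t)
  · exact ⟨{t}, (ContinuousLinearMap.fst ℝ ℝ ℝ).comp (.proj ⟨t, by simp⟩), fun _ ↦ rfl⟩
  · exact ⟨{t}, (ContinuousLinearMap.snd ℝ ℝ ℝ).comp (.proj ⟨t, by simp⟩), fun _ ↦ rfl⟩

lemma symm (hW : IsCorrelatedBrownianPair ρ W₁ W₂ Q) :
    IsCorrelatedBrownianPair ρ W₂ W₁ Q where
  brownian_fst := hW.brownian_snd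
  brownian_snd := hW.brownian_fst
  indep_increments :=
    hW.indep_increments.map (ContinuousLinearEquiv.prodComm ℝ ℝ ℝ : ℝ × ℝ →L[ℝ] ℝ × ℝ)
  gaussian_pair t :=
    (hW.gaussian_pair t).map (ContinuousLinearEquiv.prodComm ℝ ℝ ℝ : ℝ × ℝ →L[ℝ] ℝ × ℝ)
  covariance_eq t := by rw [covariance_comm, hW.covariance_eq]

lemma memLp_fst (hW : IsCorrelatedBrownianPair ρ W₁ W₂ Q) (t : ℝ≥0) : MemLp (W₁ t) 2 Q :=
  (hW.brownian_fst.isGaussianProcess.hasGaussianLaw_eval t).memLp_two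

lemma memLp_snd (hW : IsCorrelatedBrownianPair ρ W₁ W₂ Q) (t : ℝ≥0) : MemLp (W₂ t) 2 Q :=
  hW.symm.memLp_fst t

/-- The increment of the pair after `s` is independent of its value at `s`, so only the covariance
at time `s` contributes. -/
lemma covariance_eval_of_le [IsProbabilityMeasure Q] (hW : IsCorrelatedBrownianPair ρ W₁ W₂ Q)
    {s t : ℝ≥0} (hst : s ≤ t) : cov[W₁ s, W₂ t; Q] = ρ * s := by
  have hindep : (fun ω ↦ (W₁ s ω, W₂ s ω)) ⟂ᵢ[Q]
      ((fun ω ↦ (W₁ t ω, W₂ t ω)) - fun ω ↦ (W₁ s ω, W₂ s ω)) := by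
    refine hW.indep_increments.indepFun_eval_sub (r := 0) zero_le hst ?_
    filter_upwards [hW.brownian_fst.eval_zero_ae_eq_zero, hW.brownian_snd.eval_zero_ae_eq_zero]
      with ω h1 h2
    simp [h1, h2]
  have hcov : cov[W₁ s, W₂ t - W₂ s; Q] = 0 :=
    (hindep.comp measurable_fst measurable_snd).covariance_eq_zero (hW.memLp_fst s)
      ((hW.memLp_snd t).sub (hW.memLp_snd s))
  rw [covariance_sub_right (hW.memLp_fst s) (hW.memLp_snd t) (hW.memLp_snd s), sub_eq_zero] at hcov
  rw [hcov, hW.covariance_eq]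

lemma covariance_eval [IsProbabilityMeasure Q] (hW : IsCorrelatedBrownianPair ρ W₁ W₂ Q)
    (s t : ℝ≥0) : cov[W₁ s, W₂ t; Q] = ρ * min (s : ℝ) t := by
  rcases le_total s t with hst | hts
  · rw [hW.covariance_eval_of_le hst, min_eq_left (by exact_mod_cast hst)]
  · rw [covariance_comm, hW.symm.covariance_eval_of_le hts, min_eq_right (by exact_mod_cast hts)]

end IsCorrelatedBrownianPair

end CorrelatedBrownianPair

/-! ### Brownian motion as a curve in `L²` -/

section BrownianLp

variable {Ω : Type*} [MeasurableSpace Ω] {Q : Measure Ω} {B : ℝ≥0 → Ω → ℝ}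

/-- Brownian motion as a path in `L²`, extended by its initial value to negative times. -/
noncomputable def brownianLp (hB : IsBrownianReal B Q) (u : ℝ) : Lp ℝ 2 Q :=
  (hB.isGaussianProcess.hasGaussianLaw_eval u.toNNReal).memLp_two.toLp

lemma brownianLp_ae_eq (hB : IsBrownianReal B Q) (u : ℝ) :
    brownianLp hB u =ᵐ[Q] B u.toNNReal :=
  MemLp.coeFn_toLp _

lemma brownianLp_coe_toNNReal (hB : IsBrownianReal B Q) (u : ℝ) :
    brownianLp hB (u.toNNReal : ℝ) = brownianLp hB u := by
  simp only [brownianLp, Real.toNNReal_coe]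

lemma integral_brownianLp (hB : IsBrownianReal B Q) (u : ℝ) : ∫ ω, brownianLp hB u ω ∂Q = 0 := by
  rw [integral_congr_ae (brownianLp_ae_eq hB u), hB.integral_eval]

variable [IsProbabilityMeasure Q]

lemma inner_brownianLp {B' : ℝ≥0 → Ω → ℝ} (hB : IsBrownianReal B Q) (hB' : IsBrownianReal B' Q)
    (s t : ℝ) : inner ℝ (brownianLp hB s) (brownianLp hB' t) =
      cov[B s.toNNReal, B' t.toNNReal; Q] := by
  rw [← covariance_congr_ae (brownianLp_ae_eq hB s) (brownianLp_ae_eq hB' t),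
    covariance_eq_inner_sub, integral_brownianLp, zero_mul, sub_zero]

lemma continuous_brownianLp (hB : IsBrownianReal B Q) : Continuous (brownianLp hB) := by
  have hcont : Continuous fun s : ℝ≥0 ↦ brownianLp hB s := by
    refine continuous_of_inner_eq_min fun s t ↦ ?_
    rw [inner_brownianLp]
    simp [hB.covariance_eval]
  convert! hcont.comp continuous_real_toNNReal using 1
  ext1 u
  exact (brownianLp_coe_toNNReal hB u).symm

lemma inner_brownianLp_self (hB : IsBrownianReal B Q) {s t : ℝ} (hs : 0 ≤ s) (ht : 0 ≤ t) :
    inner ℝ (brownianLp hB s) (brownianLp hB t) = 1 * min s t := by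
  rw [inner_brownianLp, hB.covariance_eval]
  simp [hs, ht]

lemma IsCorrelatedBrownianPair.inner_brownianLp {ρ : ℝ} {W₁ W₂ : ℝ≥0 → Ω → ℝ}
    (hW : IsCorrelatedBrownianPair ρ W₁ W₂ Q) {s t : ℝ} (hs : 0 ≤ s) (ht : 0 ≤ t) :
    inner ℝ (brownianLp hW.brownian_fst s) (brownianLp hW.brownian_snd t) = ρ * min s t := by
  rw [_root_.inner_brownianLp, hW.covariance_eval]
  simp [hs, ht]

/-- The expectation is the inner product with the constant `1`, so it passes under the integral,
where Brownian motion has mean zero. -/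
lemma integral_expIntegral_brownianLp (hB : IsBrownianReal B Q) (κ t : ℝ) :
    ∫ ω, (expIntegral κ (brownianLp hB) t : Lp ℝ 2 Q) ω ∂Q = 0 := by
  rw [integral_eq_inner_one, inner_expIntegral (continuous_brownianLp hB)]
  simp only [← integral_eq_inner_one, integral_brownianLp, expIntegral_zero]

lemma IsVasicekSolution.ae_eq_expIntegral_brownianLp {κ θ σ r₀ : ℝ} {r : ℝ≥0 → Ω → ℝ}
    (hr : IsVasicekSolution κ θ σ r₀ B r Q) (hB : IsBrownianReal B Q) (t : ℝ≥0) :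
    ∀ᵐ ω ∂Q, r t ω = r₀ * Real.exp (-κ * t) + θ * (1 - Real.exp (-κ * t))
      + σ * Real.exp (-κ * t) * (expIntegral κ (brownianLp hB) t : Lp ℝ 2 Q) ω := by
  filter_upwards [hr.ae_eq_expIntegral hB.cont,
    coeFn_expIntegral_ae_eq (brownianLp_ae_eq hB) (continuous_brownianLp hB)
      (by filter_upwards [hB.cont] with ω h using h.comp continuous_real_toNNReal) κ t.2]
    with ω h1 h2
  rw [h1 t]
  simp only [NNReal.val_eq_coe] at h2
  rw [h2]

/-- The linear combinations of the exponential integrals of two correlated Brownian motions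
are jointly Gaussian. -/
lemma IsCorrelatedBrownianPair.isGaussianProcess_expIntegral {S : Type*} {ρ : ℝ}
    {W₁ W₂ : ℝ≥0 → Ω → ℝ} (hW : IsCorrelatedBrownianPair ρ W₁ W₂ Q) (κ₁ κ₂ : ℝ) (a b : S → ℝ)
    (τ : S → ℝ≥0) :
    IsGaussianProcess (fun s ω ↦ (a s • expIntegral κ₁ (brownianLp hW.brownian_fst) (τ s)
      + b s • expIntegral κ₂ (brownianLp hW.brownian_snd) (τ s) : Lp ℝ 2 Q) ω) Q := by
  let x : ℝ≥0 ⊕ ℝ≥0 → Lp ℝ 2 Q := Sum.elim (fun t ↦ brownianLp hW.brownian_fst t)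
    (fun t ↦ brownianLp hW.brownian_snd t)
  have hx : ∀ t, x t =ᵐ[Q] Sum.elim W₁ W₂ t := by
    rintro (t | t)
    · simpa [x] using brownianLp_ae_eq hW.brownian_fst t
    · simpa [x] using brownianLp_ae_eq hW.brownian_snd t
  have hclosed := (Submodule.span ℝ (Set.range x)).isClosed_topologicalClosure
  have hmem : ∀ t, x t ∈ (Submodule.span ℝ (Set.range x)).topologicalClosure :=
    fun t ↦ Submodule.le_topologicalClosure _ (Submodule.subset_span ⟨t, rfl⟩)
  have hfst : ∀ u, brownianLp hW.brownian_fst u ∈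
      (Submodule.span ℝ (Set.range x)).topologicalClosure := fun u ↦ by
    rw [← brownianLp_coe_toNNReal]
    exact hmem (.inl u.toNNReal)
  have hsnd : ∀ u, brownianLp hW.brownian_snd u ∈
      (Submodule.span ℝ (Set.range x)).topologicalClosure := fun u ↦ by
    rw [← brownianLp_coe_toNNReal]
    exact hmem (.inr u.toNNReal)
  exact isGaussianProcess_of_mem_submodule
    (fun z hz ↦ hW.isGaussianProcess_sumElim.hasGaussianLaw_of_mem_closure_span hx hz)
    fun s ↦ Submodule.add_mem _
      (Submodule.smul_mem _ _
        (expIntegral_mem hclosed (continuous_brownianLp _) hfst κ₁ (τ s).2))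
      (Submodule.smul_mem _ _
        (expIntegral_mem hclosed (continuous_brownianLp _) hsnd κ₂ (τ s).2))

end BrownianLp

/-! ### The logarithm of the bond price -/

theorem proposition1 {Ω : Type*} [MeasurableSpace Ω] (Q : Measure Ω) [IsProbabilityMeasure Q]
    (κ₁ κ₂ θ₁ θ₂ σ₁ σ₂ ρ r₀₁ r₀₂ : ℝ) (hκ₁ : 0 < κ₁) (hκ₂ : 0 < κ₂)
    (W₁ W₂ r₁ r₂ : ℝ≥0 → Ω → ℝ)
    (hW : IsCorrelatedBrownianPair ρ W₁ W₂ Q)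
    (hr₁ : IsVasicekSolution κ₁ θ₁ σ₁ r₀₁ W₁ r₁ Q)
    (hr₂ : IsVasicekSolution κ₂ θ₂ σ₂ r₀₂ W₂ r₂ Q)
    (T δ : ℝ≥0) (P : ℝ≥0 → ℝ≥0 → ℝ≥0 → Ω → ℝ)
    (hP : ∀ t ≤ T, ∀ᵐ ω ∂Q, P t T δ ω =
      Real.exp (bondPhi κ₁ κ₂ θ₁ θ₂ σ₁ σ₂ ρ ((T : ℝ) - (t : ℝ))
        + (bondPsi₁ κ₁ ((T : ℝ) - (t : ℝ)) * r₁ t ω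
          + bondPsi₂ κ₂ ((T : ℝ) - (t : ℝ)) * r₂ t ω))) :
    IsGaussianProcess (fun (t : Set.Icc (0 : ℝ≥0) T) (ω : Ω) ↦ Real.log (P (t : ℝ≥0) T δ ω)) Q ∧
    (∀ t : ℝ≥0, t ≤ T →
      ∫ ω, Real.log (P t T δ ω) ∂Q =
        bondPhi κ₁ κ₂ θ₁ θ₂ σ₁ σ₂ ρ ((T : ℝ) - (t : ℝ))
          + bondPsi₁ κ₁ ((T : ℝ) - (t : ℝ)) *
            (r₀₁ * Real.exp (-κ₁ * (t : ℝ)) + θ₁ * (1 - Real.exp (-κ₁ * (t : ℝ))))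
          + bondPsi₂ κ₂ ((T : ℝ) - (t : ℝ)) *
            (r₀₂ * Real.exp (-κ₂ * (t : ℝ)) + θ₂ * (1 - Real.exp (-κ₂ * (t : ℝ))))) ∧
    (∀ s t : ℝ≥0, s ≤ T → t ≤ T →
      cov[fun ω ↦ Real.log (P s T δ ω), fun ω ↦ Real.log (P t T δ ω); Q] =
        bondPsi₁ κ₁ ((T : ℝ) - (s : ℝ)) * bondPsi₁ κ₁ ((T : ℝ) - (t : ℝ)) *
            (σ₁ ^ 2 / (2 * κ₁)) * Real.exp (-κ₁ * ((s : ℝ) + (t : ℝ))) *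
            (Real.exp (2 * κ₁ * min (s : ℝ) (t : ℝ)) - 1)
          + bondPsi₁ κ₁ ((T : ℝ) - (s : ℝ)) * bondPsi₂ κ₂ ((T : ℝ) - (t : ℝ)) *
            (ρ * σ₁ * σ₂ / (κ₁ + κ₂)) * Real.exp (-(κ₁ * (s : ℝ) + κ₂ * (t : ℝ))) *
            (Real.exp ((κ₁ + κ₂) * min (s : ℝ) (t : ℝ)) - 1)
          + bondPsi₁ κ₁ ((T : ℝ) - (t : ℝ)) * bondPsi₂ κ₂ ((T : ℝ) - (s : ℝ)) *
            (ρ * σ₁ * σ₂ / (κ₁ + κ₂)) * Real.exp (-(κ₁ * (t : ℝ) + κ₂ * (s : ℝ))) *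
            (Real.exp ((κ₁ + κ₂) * min (t : ℝ) (s : ℝ)) - 1)
          + bondPsi₂ κ₂ ((T : ℝ) - (s : ℝ)) * bondPsi₂ κ₂ ((T : ℝ) - (t : ℝ)) *
            (σ₂ ^ 2 / (2 * κ₂)) * Real.exp (-κ₂ * ((s : ℝ) + (t : ℝ))) *
            (Real.exp (2 * κ₂ * min (s : ℝ) (t : ℝ)) - 1)) := by
  let w₁ := brownianLp hW.brownian_fst
  let w₂ := brownianLp hW.brownian_snd
  let a : ℝ≥0 → ℝ := fun t ↦ bondPsi₁ κ₁ ((T : ℝ) - t) * (σ₁ * Real.exp (-κ₁ * t))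
  let b : ℝ≥0 → ℝ := fun t ↦ bondPsi₂ κ₂ ((T : ℝ) - t) * (σ₂ * Real.exp (-κ₂ * t))
  let z : ℝ≥0 → Lp ℝ 2 Q := fun t ↦ a t • expIntegral κ₁ w₁ t + b t • expIntegral κ₂ w₂ t
  let m : ℝ≥0 → ℝ := fun t ↦ bondPhi κ₁ κ₂ θ₁ θ₂ σ₁ σ₂ ρ ((T : ℝ) - (t : ℝ))
    + bondPsi₁ κ₁ ((T : ℝ) - (t : ℝ)) *
      (r₀₁ * Real.exp (-κ₁ * (t : ℝ)) + θ₁ * (1 - Real.exp (-κ₁ * (t : ℝ))))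
    + bondPsi₂ κ₂ ((T : ℝ) - (t : ℝ)) *
      (r₀₂ * Real.exp (-κ₂ * (t : ℝ)) + θ₂ * (1 - Real.exp (-κ₂ * (t : ℝ))))
  -- The deterministic part `m` is the claimed mean, and the centred part `z` carries all the
  -- covariance.
  have hlog : ∀ t ≤ T, (fun ω ↦ Real.log (P t T δ ω)) =ᵐ[Q] fun ω ↦ m t + z t ω := by
    intro t ht
    filter_upwards [hP t ht, hr₁.ae_eq_expIntegral_brownianLp hW.brownian_fst t,
      hr₂.ae_eq_expIntegral_brownianLp hW.brownian_snd t,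
      Lp.coeFn_add (a t • expIntegral κ₁ w₁ t) (b t • expIntegral κ₂ w₂ t),
      Lp.coeFn_smul (a t) (expIntegral κ₁ w₁ t), Lp.coeFn_smul (b t) (expIntegral κ₂ w₂ t)]
      with ω h h1 h2 h3 h4 h5
    rw [h, Real.log_exp, h1, h2, h3, Pi.add_apply, h4, h5, Pi.smul_apply, Pi.smul_apply]
    simp only [m, a, b, w₁, w₂, smul_eq_mul]
    ring
  have hz : ∀ t, ∫ ω, z t ω ∂Q = 0 := fun t ↦ by
    simp only [z, w₁, w₂, integral_eq_inner_one, inner_add_right, inner_smul_right]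
    simp only [← integral_eq_inner_one, integral_expIntegral_brownianLp, mul_zero, add_zero]
  have hzint : ∀ t, Integrable (z t) Q := fun t ↦ (Lp.memLp (z t)).integrable one_le_two
  refine ⟨?_, fun t ht ↦ ?_, fun s t hs ht ↦ ?_⟩
  · refine ((hW.isGaussianProcess_expIntegral κ₁ κ₂ (fun t : Set.Icc (0 : ℝ≥0) T ↦ a t)
      (fun t ↦ b t) (fun t ↦ t)).const_add (fun t ↦ m t)).congr fun t ↦ ?_
    exact (hlog t t.2.2).symm
  · rw [integral_congr_ae (hlog t ht), integral_add (integrable_const _) (hzint t), hz]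
    simp [m]
  · have hcov : ∀ {v w : ℝ → Lp ℝ 2 Q} {c : ℝ}, Continuous v → Continuous w →
        (∀ {s t : ℝ}, 0 ≤ s → 0 ≤ t → inner ℝ (v s) (w t) = c * min s t) → ∀ {κ l : ℝ}, 0 < κ →
        0 < l → inner ℝ (expIntegral κ v s) (expIntegral l w t) =
          c / (κ + l) * (Real.exp ((κ + l) * min (s : ℝ) t) - 1) :=
      fun hv hw h _ _ hκ hl ↦
        inner_expIntegral_expIntegral hv hw (fun _ _ ↦ h) hκ hl s.2 t.2
    have hw₁ : Continuous w₁ := continuous_brownianLp _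
    have hw₂ : Continuous w₂ := continuous_brownianLp _
    rw [covariance_congr_ae (hlog s hs) (hlog t ht), covariance_const_add_left (hzint s),
      covariance_const_add_right (hzint t), covariance_eq_inner_sub, hz, zero_mul, sub_zero]
    simp only [z, inner_add_left, inner_add_right, real_inner_smul_left, real_inner_smul_right]
    rw [hcov hw₁ hw₁ (inner_brownianLp_self hW.brownian_fst) hκ₁ hκ₁,
      hcov hw₂ hw₂ (inner_brownianLp_self hW.brownian_snd) hκ₂ hκ₂,
      hcov hw₁ hw₂ hW.inner_brownianLp hκ₁ hκ₂,
      hcov hw₂ hw₁ hW.symm.inner_brownianLp hκ₂ hκ₁, min_comm (t : ℝ) (s : ℝ), add_comm κ₂ κ₁,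
      ← two_mul, ← two_mul]
    have hexp : ∀ x y : ℝ, Real.exp (-(x + y)) = Real.exp (-x) * Real.exp (-y) := fun x y ↦ by
      rw [neg_add, Real.exp_add]
    have hexp' : ∀ κ x y : ℝ, Real.exp (-κ * (x + y)) = Real.exp (-κ * x) * Real.exp (-κ * y) :=
      fun κ x y ↦ by rw [mul_add, Real.exp_add]
    simp only [a, b, hexp', hexp, ← neg_mul]
    ring
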